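/- Let $d\ge 1$ and let $f\in C^1([0,1]^d)$ be real-valued. Put $\mu=\int_{[0,1]^d} f(x)\,dx$ and $\sigma^2=\frac1{12}\int_{[0,1]^d}\|\nabla f(x)\|^2\,dx$, where $\|\cdot\|$ is the Euclidean norm, and assume $\sigma^2>0$ (with $\sigma>0$ its square root). For each integer $m\ge 1$ let $n=m^d$, split $[0,1]^d$ into the $n$ congruent subcubes $E_1,\dots,E_n$ of side length $1/m$ of the regular grid, let $U_1,\dots,U_n$ be independent random points with $U_i$ uniformly distributed on $E_i$, and let $$\tilde\mu_n=\frac1n\sum_{i=1}^n f(U_i)$$ be the stratified estimate of $\mu$. Then $$\frac{\tilde\mu_n-\mu}{\sigma\, n^{-1/2-1/d}}\longrightarrow N(0,1)\quad\text{in distribution, as } n=m^d\to\infty.$$ -/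

import Mathlib

open MeasureTheory ProbabilityTheory Filter
open scoped Topology

noncomputable section

/-- The unit cube `[0,1]^d` in Euclidean space. -/
def unitCube (d : ℕ) : Set (EuclideanSpace ℝ (Fin d)) :=
  {x | ∀ j, x j ∈ Set.Icc (0 : ℝ) 1}

/-- The regular grid on `[0,1]^d` with `m` subdivisions per axis: its `m ^ d` cells, of side `1 / m`,
are indexed by `k : Fin d → Fin m`, and the cell `k` is `∏ j, [k j / m, (k j + 1) / m]`. -/
def gridCell (d m : ℕ) (k : Fin d → Fin m) : Set (EuclideanSpace ℝ (Fin d)) :=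
  {x | ∀ j, x j ∈ Set.Icc (((k j : ℕ) : ℝ) / (m : ℝ)) ((((k j : ℕ) : ℝ) + 1) / (m : ℝ))}

/-- `U` is a stratified sample on the grid with `m ^ d` cells: one point `U k` for each cell `k`,
uniformly distributed (with respect to Lebesgue measure) on that cell, and the points are
independent. -/
structure IsGridSample {Ω : Type*} [MeasurableSpace Ω] (P : Measure Ω) (d m : ℕ)
    (U : (Fin d → Fin m) → Ω → EuclideanSpace ℝ (Fin d)) : Prop where
  uniform : ∀ k, pdf.IsUniform (U k) (gridCell d m k) P volume
  indep : iIndepFun U P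

/-- The stratified estimate `(1 / n) ∑ₖ f (U k)` with `n = m ^ d`. -/
def gridEstimate {Ω : Type*} {d m : ℕ} (f : EuclideanSpace ℝ (Fin d) → ℝ)
    (U : (Fin d → Fin m) → Ω → EuclideanSpace ℝ (Fin d)) (ω : Ω) : ℝ :=
  (1 / ((m ^ d : ℕ) : ℝ)) * ∑ k, f (U k ω)

/-- The integral `∫_{[0,1]^d} f(x) dx`. -/
def cubeIntegral {d : ℕ} (f : EuclideanSpace ℝ (Fin d) → ℝ) : ℝ :=
  ∫ x in unitCube d, f x

/-- The number `σ² = (1 / 12) ∫_{[0,1]^d} ‖∇f(x)‖² dx`. The gradient is taken within the cube, so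
that it is one-sided on the boundary and only the values of `f` on the cube matter. -/
def gridSigmaSq {d : ℕ} (f : EuclideanSpace ℝ (Fin d) → ℝ) : ℝ :=
  (1 / 12) * ∫ x in unitCube d, ‖gradientWithin f (unitCube d) x‖ ^ 2

end

/-! On a cell of side `1/m` the function is affine up to an error `o(1/m)`, uniformly over cells,
because its gradient is uniformly continuous on the compact cube. A linear form `⟨g, x⟩` has
variance exactly `‖g‖² / (12 m²)` on such a cell (`variance_inner_gridCell`). Hence `m²` times the
average cell variance differs by `o(1)` from the average of `‖∇f‖² / 12` over the cube, which is
`σ²` (`tendsto_sum_variance_gridCell`).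

Since `n^(1/d) = m`, the normalized error is a sum of independent centred terms whose variances add
up to a quantity tending to 1 (`gridEstimate_normalized_eq_sum`). By the mean value inequality each
term is `O(n^(-1/2))`, uniformly in the cell. For such arrays the central limit theorem needs no
finer Lindeberg condition (`tendstoInDistribution_sum_of_bounded`): each characteristic function is
close to a Gaussian one with the same variance, the factors of the two products are exchanged one at
a time, and Lévy's theorem concludes. -/

/-! ### Central limit theorem for uniformly small bounded arrays. -/

theorem Finset.norm_prod_sub_prod_le_sum {ι 𝕜 : Type*} [NormedField 𝕜] (s : Finset ι)
    {a b : ι → 𝕜} (ha : ∀ i ∈ s, ‖a i‖ ≤ 1) (hb : ∀ i ∈ s, ‖b i‖ ≤ 1) :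
    ‖∏ i ∈ s, a i - ∏ i ∈ s, b i‖ ≤ ∑ i ∈ s, ‖a i - b i‖ := by
  classical
  induction s using Finset.induction with
  | empty => simp
  | insert i s hi ih =>
    rw [Finset.prod_insert hi, Finset.prod_insert hi, Finset.sum_insert hi]
    have h1 : ‖∏ j ∈ s, a j‖ ≤ 1 := by
      rw [norm_prod]
      exact Finset.prod_le_one (fun _ _ => norm_nonneg _)
        fun j hj => ha j (Finset.mem_insert_of_mem hj)
    have h2 := ih (fun j hj => ha j (Finset.mem_insert_of_mem hj))
      (fun j hj => hb j (Finset.mem_insert_of_mem hj))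
    have h3 := hb i (Finset.mem_insert_self i s)
    calc ‖a i * ∏ j ∈ s, a j - b i * ∏ j ∈ s, b j‖
        = ‖(a i - b i) * ∏ j ∈ s, a j + b i * (∏ j ∈ s, a j - ∏ j ∈ s, b j)‖ := by
          congr 1; ring
      _ ≤ ‖a i - b i‖ * ‖∏ j ∈ s, a j‖ + ‖b i‖ * ‖∏ j ∈ s, a j - ∏ j ∈ s, b j‖ := by
          rw [← norm_mul, ← norm_mul]; exact norm_add_le _ _
      _ ≤ ‖a i - b i‖ + ∑ j ∈ s, ‖a j - b j‖ := by
          refine add_le_add (mul_le_of_le_one_right (norm_nonneg _) h1) (le_trans ?_ h2)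
          exact mul_le_of_le_one_left (norm_nonneg _) h3

theorem Complex.norm_exp_mul_I_sub_taylor_two_le {y : ℝ} (hy : |y| ≤ 1) :
    ‖Complex.exp (y * Complex.I) - (1 + y * Complex.I - (y : ℂ) ^ 2 / 2)‖ ≤ 3 * |y| ^ 3 := by
  have h := Complex.norm_exp_sub_sum_le_norm_mul_exp (y * Complex.I) 3
  have hn : ‖(y : ℂ) * Complex.I‖ = |y| := by simp
  rw [hn] at h
  have hs : ∑ m ∈ Finset.range 3, ((y : ℂ) * Complex.I) ^ m / (m.factorial : ℂ)
      = 1 + y * Complex.I - (y : ℂ) ^ 2 / 2 := by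
    simp [Finset.sum_range_succ, Nat.factorial, mul_pow]
    ring
  rw [hs] at h
  refine h.trans ?_
  have he : Real.exp |y| ≤ 3 :=
    (Real.exp_le_exp.2 hy).trans (Real.exp_one_lt_d9.le.trans (by norm_num))
  nlinarith [pow_nonneg (abs_nonneg y) 3]

/-- Both sides are compared with `1 - s²v/2`. Trading one factor `|X|` of the cubic remainder for
`c` makes the bound proportional to the variance, so that it can be summed over an array. -/
theorem norm_charFun_sub_exp_le_of_bounded {Ω : Type*} [MeasurableSpace Ω] {P : Measure Ω}
    [IsProbabilityMeasure P] {X : Ω → ℝ} (hX : AEMeasurable X P) (h0 : ∫ ω, X ω ∂P = 0)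
    {c : ℝ} (hc : 0 ≤ c) (hb : ∀ᵐ ω ∂P, |X ω| ≤ c) {s : ℝ} (hs : |s| * c ≤ 1) :
    ‖charFun (P.map X) s - Complex.exp (-(s ^ 2 * (∫ ω, X ω ^ 2 ∂P) / 2 : ℝ))‖
      ≤ (3 * |s| ^ 3 * c + s ^ 4 * c ^ 2) * ∫ ω, X ω ^ 2 ∂P := by
  set v := ∫ ω, X ω ^ 2 ∂P with hv
  have hv0 : 0 ≤ v := integral_nonneg fun ω => sq_nonneg _
  have hXi : Integrable X P := Integrable.of_bound hX.aestronglyMeasurable c (by simpa using hb)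
  have hX2 : Integrable (fun ω => X ω ^ 2) P := by
    refine Integrable.of_bound (hX.pow_const 2).aestronglyMeasurable (c ^ 2) ?_
    filter_upwards [hb] with ω hω
    rw [Real.norm_eq_abs, abs_pow]
    exact pow_le_pow_left₀ (abs_nonneg _) hω 2
  have hvc : v ≤ c ^ 2 := by
    have : v ≤ ∫ _, c ^ 2 ∂P := by
      refine integral_mono_ae hX2 (integrable_const _) ?_
      filter_upwards [hb] with ω hω
      rw [← sq_abs]
      exact pow_le_pow_left₀ (abs_nonneg _) hω 2
    simpa using this
  have hexp : Integrable (fun ω => Complex.exp ((s * X ω : ℝ) * Complex.I)) P := by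
    refine Integrable.of_bound (C := 1) ?_ (Eventually.of_forall fun ω => ?_)
    · refine AEMeasurable.aestronglyMeasurable ?_
      fun_prop
    · rw [Complex.norm_exp_ofReal_mul_I]
  have hcf : charFun (P.map X) s = ∫ ω, Complex.exp ((s * X ω : ℝ) * Complex.I) ∂P := by
    rw [charFun_apply_real, integral_map hX (by fun_prop)]
    simp
  have hlin : Integrable (fun ω => ((s * X ω : ℝ) : ℂ) * Complex.I) P :=
    ((hXi.const_mul s).ofReal).mul_const _
  have hquad : Integrable (fun ω => ((s * X ω : ℝ) : ℂ) ^ 2 / 2) P := by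
    have : (fun ω => ((s * X ω : ℝ) : ℂ) ^ 2 / 2) = fun ω => ((s ^ 2 * X ω ^ 2 / 2 : ℝ) : ℂ) := by
      ext ω; push_cast; ring
    rw [this]
    exact ((hX2.const_mul _).div_const _).ofReal
  have hone : Integrable (fun ω => 1 + ((s * X ω : ℝ) : ℂ) * Complex.I) P :=
    (integrable_const _).add hlin
  have htay : ∫ ω, (1 + ((s * X ω : ℝ) : ℂ) * Complex.I - ((s * X ω : ℝ) : ℂ) ^ 2 / 2) ∂P
      = 1 - ((s ^ 2 * v / 2 : ℝ) : ℂ) := by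
    rw [integral_sub hone hquad,
      integral_add (integrable_const _) hlin, integral_mul_const, integral_complex_ofReal,
      integral_const_mul, h0]
    have : (fun ω => ((s * X ω : ℝ) : ℂ) ^ 2 / 2) = fun ω => ((s ^ 2 * X ω ^ 2 / 2 : ℝ) : ℂ) := by
      ext ω; push_cast; ring
    rw [this, integral_complex_ofReal, integral_div, integral_const_mul]
    simp [hv]
  have h1 : ‖charFun (P.map X) s - (1 - ((s ^ 2 * v / 2 : ℝ) : ℂ))‖ ≤ 3 * |s| ^ 3 * c * v := by
    rw [hcf, ← htay, ← integral_sub hexp (hone.sub' hquad)]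
    have : 3 * |s| ^ 3 * c * v = ∫ ω, 3 * |s| ^ 3 * c * X ω ^ 2 ∂P := by
      rw [integral_const_mul]
    rw [this]
    refine norm_integral_le_of_norm_le (hX2.const_mul _) ?_
    filter_upwards [hb] with ω hω
    have hy : |s * X ω| ≤ 1 := by
      rw [abs_mul]; exact (mul_le_mul_of_nonneg_left hω (abs_nonneg _)).trans hs
    refine (Complex.norm_exp_mul_I_sub_taylor_two_le hy).trans ?_
    rw [abs_mul, mul_pow, pow_succ |X ω| 2, sq_abs]
    have := mul_le_mul_of_nonneg_left hω (by positivity : 0 ≤ 3 * |s| ^ 3 * X ω ^ 2)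
    linarith
  have h2 : ‖(1 - ((s ^ 2 * v / 2 : ℝ) : ℂ)) - Complex.exp (-(s ^ 2 * v / 2 : ℝ))‖
      ≤ s ^ 4 * c ^ 2 * v := by
    set u := s ^ 2 * v / 2 with hu
    have hsc : s ^ 2 * c ^ 2 ≤ 1 := by
      rw [← sq_abs s, ← mul_pow]; exact pow_le_one₀ (by positivity) hs
    have hu0 : 0 ≤ u := by positivity
    have hu1 : u ≤ 1 := by
      have := mul_le_mul_of_nonneg_left hvc (sq_nonneg s)
      linarith
    have h := Real.abs_exp_sub_one_sub_id_le (x := -u) (by rw [abs_neg, abs_of_nonneg hu0]; exact hu1)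
    rw [norm_sub_rev]
    have e : Complex.exp (-(u : ℝ)) - (1 - (u : ℂ)) = ((Real.exp (-u) - 1 - (-u) : ℝ) : ℂ) := by
      push_cast; ring
    rw [e, Complex.norm_real]
    refine h.trans ?_
    -- The remainder is at most `u² = s⁴v²/4`, and `v ≤ c²` turns one factor `v` into `c²`.
    have := mul_le_mul_of_nonneg_left hvc (by positivity : 0 ≤ s ^ 4 * v)
    rw [hu]
    nlinarith [mul_nonneg (by positivity : 0 ≤ s ^ 4) (sq_nonneg v)]
  calc _ ≤ _ := norm_sub_le_norm_sub_add_norm_sub _ (1 - ((s ^ 2 * v / 2 : ℝ) : ℂ)) _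
    _ ≤ _ := add_le_add h1 h2
    _ = _ := by ring

theorem tendsto_charFun_sum_of_bounded {ι : ℕ → Type*} [∀ m, Fintype (ι m)]
    {Ω : ℕ → Type*} [∀ m, MeasurableSpace (Ω m)] {P : ∀ m, Measure (Ω m)}
    [∀ m, IsProbabilityMeasure (P m)] {X : ∀ m, ι m → Ω m → ℝ}
    (hX : ∀ m k, AEMeasurable (X m k) (P m)) (hindep : ∀ m, iIndepFun (X m) (P m))
    (h0 : ∀ m k, ∫ ω, X m k ω ∂P m = 0) {C : ℕ → ℝ} (hC0 : ∀ m, 0 ≤ C m)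
    (hb : ∀ m k, ∀ᵐ ω ∂P m, |X m k ω| ≤ C m) (hC : Tendsto C atTop (𝓝 0)) {v : ℝ}
    (hV : Tendsto (fun m => ∑ k, ∫ ω, X m k ω ^ 2 ∂P m) atTop (𝓝 v)) (t : ℝ) :
    Tendsto (fun m => charFun ((P m).map (fun ω => ∑ k, X m k ω)) t) atTop
      (𝓝 (Complex.exp (-(t ^ 2 * v / 2 : ℝ)))) := by
  have hlim : Tendsto (fun m => Complex.exp
      (-(t ^ 2 * (∑ k, ∫ ω, X m k ω ^ 2 ∂P m) / 2 : ℝ))) atTop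
      (𝓝 (Complex.exp (-(t ^ 2 * v / 2 : ℝ)))) := by
    have hc : Continuous fun x : ℝ => Complex.exp (-(t ^ 2 * x / 2 : ℝ)) := by fun_prop
    exact (hc.tendsto v).comp hV
  have hdiff : Tendsto (fun m => charFun ((P m).map (fun ω => ∑ k, X m k ω)) t -
      Complex.exp (-(t ^ 2 * (∑ k, ∫ ω, X m k ω ^ 2 ∂P m) / 2 : ℝ))) atTop (𝓝 0) := by
    have hg : Tendsto (fun m => (3 * |t| ^ 3 * C m + t ^ 4 * C m ^ 2) *
        ∑ k, ∫ ω, X m k ω ^ 2 ∂P m) atTop (𝓝 0) := by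
      have := ((hC.const_mul (3 * |t| ^ 3)).add ((hC.pow 2).const_mul (t ^ 4))).mul hV
      simpa using this
    refine squeeze_zero_norm' ?_ hg
    -- The Taylor estimates require `|t| C m ≤ 1`, which holds only for large `m`.
    have hsmall : ∀ᶠ m in atTop, |t| * C m ≤ 1 := by
      have : Tendsto (fun m => |t| * C m) atTop (𝓝 0) := by simpa using hC.const_mul |t|
      exact (this.eventually_lt_const one_pos).mono fun _ h => h.le
    filter_upwards [hsmall] with m hm
    rw [(hindep m).charFun_map_fun_sum_eq_prod (hX m), Finset.prod_apply]
    have he : Complex.exp (-(t ^ 2 * (∑ k, ∫ ω, X m k ω ^ 2 ∂P m) / 2 : ℝ)) =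
        ∏ k, Complex.exp (-(t ^ 2 * (∫ ω, X m k ω ^ 2 ∂P m) / 2 : ℝ)) := by
      rw [← Complex.exp_sum]
      congr 1
      push_cast
      rw [Finset.sum_neg_distrib, Finset.mul_sum, Finset.sum_div]
    rw [he, Finset.mul_sum]
    have hpr k : IsProbabilityMeasure ((P m).map (X m k)) := Measure.isProbabilityMeasure_map (hX m k)
    refine (Finset.norm_prod_sub_prod_le_sum _ (fun k _ => ?_) (fun k _ => ?_)).trans
      (Finset.sum_le_sum fun k _ =>
        norm_charFun_sub_exp_le_of_bounded (hX m k) (h0 m k) (hC0 m) (hb m k) hm)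
    · exact norm_charFun_le_one t
    · rw [← Complex.ofReal_neg, Complex.norm_exp_ofReal, Real.exp_le_one_iff, neg_nonpos]
      have : 0 ≤ ∫ ω, X m k ω ^ 2 ∂P m := integral_nonneg fun ω => sq_nonneg _
      positivity
  simpa using hdiff.add hlim

theorem tendstoInDistribution_sum_of_bounded {ι : ℕ → Type*} [∀ m, Fintype (ι m)]
    {Ω : ℕ → Type*} [∀ m, MeasurableSpace (Ω m)] {P : ∀ m, Measure (Ω m)}
    [∀ m, IsProbabilityMeasure (P m)] {X : ∀ m, ι m → Ω m → ℝ}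
    (hX : ∀ m k, AEMeasurable (X m k) (P m)) (hindep : ∀ m, iIndepFun (X m) (P m))
    (h0 : ∀ m k, ∫ ω, X m k ω ∂P m = 0) {C : ℕ → ℝ} (hC0 : ∀ m, 0 ≤ C m)
    (hb : ∀ m k, ∀ᵐ ω ∂P m, |X m k ω| ≤ C m) (hC : Tendsto C atTop (𝓝 0))
    (hV : Tendsto (fun m => ∑ k, ∫ ω, X m k ω ^ 2 ∂P m) atTop (𝓝 1)) :
    TendstoInDistribution (fun m ω => ∑ k, X m k ω) atTop (id : ℝ → ℝ) P (gaussianReal 0 1) where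
  forall_aemeasurable m := Finset.aemeasurable_fun_sum _ fun k _ => hX m k
  tendsto := by
    refine ProbabilityMeasure.tendsto_iff_tendsto_charFun.2 fun t => ?_
    have h := tendsto_charFun_sum_of_bounded hX hindep h0 hC0 hb hC hV t
    simpa [charFun_gaussianReal] using h

/-! ### Variance of a linear form on a box. -/

theorem variance_id_cond_Icc {a b : ℝ} (hab : a < b) :
    Var[fun x : ℝ => x; cond volume (Set.Icc a b)] = (b - a) ^ 2 / 12 := by
  have hv : volume (Set.Icc a b) = ENNReal.ofReal (b - a) := Real.volume_Icc
  have h0 : volume (Set.Icc a b) ≠ 0 := by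
    rw [hv]; simpa using hab
  have := cond_isProbabilityMeasure_of_finite h0 (by rw [hv]; exact ENNReal.ofReal_ne_top)
  have hmem : MemLp (fun x : ℝ => x) 2 (cond volume (Set.Icc a b)) := by
    refine MemLp.of_bound (by fun_prop) (max |a| |b|) ?_
    filter_upwards [ae_cond_mem measurableSet_Icc] with x hx
    exact abs_le_max_abs_abs hx.1 hx.2
  have hint : ∀ n : ℕ, ∫ x, x ^ n ∂(cond volume (Set.Icc a b)) =
      (b - a)⁻¹ * ((b ^ (n + 1) - a ^ (n + 1)) / (n + 1)) := by
    intro n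
    rw [ProbabilityTheory.cond, integral_smul_measure, integral_Icc_eq_integral_Ioc,
      ← intervalIntegral.integral_of_le hab.le, integral_pow, hv, ENNReal.toReal_inv,
      ENNReal.toReal_ofReal (by linarith), smul_eq_mul]
  rw [variance_eq_sub hmem]
  have h1 := hint 1
  have h2 := hint 2
  simp only [pow_one] at h1
  simp only [Pi.pow_apply]
  rw [h1, h2]
  have : b - a ≠ 0 := by linarith
  field_simp
  push_cast
  ring

theorem variance_linear_pi_cond_Icc {ι : Type*} [Fintype ι] {a b : ι → ℝ} (hab : ∀ j, a j < b j)
    (g : ι → ℝ) :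
    Var[fun x : ι → ℝ => ∑ j, g j * x j; Measure.pi fun j => cond volume (Set.Icc (a j) (b j))]
      = ∑ j, g j ^ 2 * ((b j - a j) ^ 2 / 12) := by
  have hp j : IsProbabilityMeasure (cond (volume : Measure ℝ) (Set.Icc (a j) (b j))) := by
    refine cond_isProbabilityMeasure_of_finite ?_ ?_ <;> rw [Real.volume_Icc]
    · simpa using hab j
    · exact ENNReal.ofReal_ne_top
  have h := variance_sum_pi (μ := fun j => cond (volume : Measure ℝ) (Set.Icc (a j) (b j)))
    (X := fun j x => g j * x) (fun j => by
      refine MemLp.of_bound (by fun_prop) (|g j| * max |a j| |b j|) ?_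
      filter_upwards [ae_cond_mem measurableSet_Icc] with x hx
      rw [norm_mul]
      exact mul_le_mul_of_nonneg_left (abs_le_max_abs_abs hx.1 hx.2) (abs_nonneg _))
  have e : (∑ j, fun x : ι → ℝ => g j * x j) = fun x : ι → ℝ => ∑ j, g j * x j := by
    ext x; simp
  rw [e] at h
  rw [h]
  refine Finset.sum_congr rfl fun j _ => ?_
  rw [variance_const_mul, variance_id_cond_Icc (hab j)]

/-- The uniform distribution on a box is the product of the uniform distributions on its sides. -/
theorem map_ofLp_cond_box {ι : Type*} [Fintype ι] {a b : ι → ℝ} (hab : ∀ j, a j < b j) :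
    (cond (volume : Measure (EuclideanSpace ℝ ι))
      (WithLp.ofLp ⁻¹' (Set.univ.pi fun j => Set.Icc (a j) (b j)))).map WithLp.ofLp
      = Measure.pi fun j => cond volume (Set.Icc (a j) (b j)) := by
  have hp j : IsProbabilityMeasure (cond (volume : Measure ℝ) (Set.Icc (a j) (b j))) := by
    refine cond_isProbabilityMeasure_of_finite ?_ ?_ <;> rw [Real.volume_Icc]
    · simpa using hab j
    · exact ENNReal.ofReal_ne_top
  have hof := PiLp.volume_preserving_ofLp ι
  have hbox : MeasurableSet (Set.univ.pi fun j => Set.Icc (a j) (b j)) :=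
    MeasurableSet.univ_pi fun j => measurableSet_Icc
  refine (Measure.pi_eq fun s hs => ?_).symm
  have hms : MeasurableSet (Set.univ.pi s) := MeasurableSet.univ_pi hs
  rw [Measure.map_apply hof.measurable hms, cond_apply (hof.measurable hbox),
    ← Set.preimage_inter, hof.measure_preimage hbox.nullMeasurableSet,
    hof.measure_preimage (hbox.inter hms).nullMeasurableSet, ← Set.pi_inter_distrib, volume_pi_pi,
    volume_pi_pi, ENNReal.prod_inv_distrib, ← Finset.prod_mul_distrib]
  · exact Finset.prod_congr rfl fun j _ => (cond_apply measurableSet_Icc _ _).symm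
  · intro i _ j _ _
    right
    rw [Real.volume_Icc]
    exact ENNReal.ofReal_ne_top

/-! ### Measure and geometry of the grid cells. -/

theorem gridCell_eq_preimage (d m : ℕ) (k : Fin d → Fin m) :
    gridCell d m k = WithLp.ofLp ⁻¹' (Set.univ.pi fun j =>
      Set.Icc (((k j : ℕ) : ℝ) / (m : ℝ)) ((((k j : ℕ) : ℝ) + 1) / (m : ℝ))) := by
  ext x; simp only [gridCell, Set.mem_preimage, Set.mem_univ_pi, Set.mem_ofPred_eq]

theorem measurableSet_gridCell (d m : ℕ) (k : Fin d → Fin m) : MeasurableSet (gridCell d m k) := by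
  rw [gridCell_eq_preimage]
  exact (PiLp.volume_preserving_ofLp _).measurable
    (MeasurableSet.univ_pi fun j => measurableSet_Icc)

theorem volume_gridCell {d m : ℕ} (hm : 0 < m) (k : Fin d → Fin m) :
    volume (gridCell d m k) = ENNReal.ofReal (1 / ((m ^ d : ℕ) : ℝ)) := by
  rw [gridCell_eq_preimage, (PiLp.volume_preserving_ofLp _).measure_preimage
    (MeasurableSet.univ_pi fun j => measurableSet_Icc).nullMeasurableSet, volume_pi_pi]
  have : ∀ j, volume (Set.Icc (((k j : ℕ) : ℝ) / (m : ℝ)) ((((k j : ℕ) : ℝ) + 1) / (m : ℝ)))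
      = ENNReal.ofReal (1 / m) := by
    intro j; rw [Real.volume_Icc]; congr 1; ring
  simp_rw [this]
  rw [Finset.prod_const, ← ENNReal.ofReal_pow (by positivity)]
  simp

theorem volume_gridCell_ne_zero {d m : ℕ} (hm : 0 < m) (k : Fin d → Fin m) :
    volume (gridCell d m k) ≠ 0 := by
  rw [volume_gridCell hm]
  have : 0 < 1 / ((m ^ d : ℕ) : ℝ) := by positivity
  exact (ENNReal.ofReal_pos.2 this).ne'

theorem volume_gridCell_ne_top {d m : ℕ} (hm : 0 < m) (k : Fin d → Fin m) :
    volume (gridCell d m k) ≠ ⊤ := by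
  rw [volume_gridCell hm]
  exact ENNReal.ofReal_ne_top

theorem integral_cond_gridCell {d m : ℕ} (hm : 0 < m) (k : Fin d → Fin m)
    (g : EuclideanSpace ℝ (Fin d) → ℝ) :
    ∫ x, g x ∂(cond volume (gridCell d m k)) = ((m ^ d : ℕ) : ℝ) * ∫ x in gridCell d m k, g x := by
  rw [ProbabilityTheory.cond, integral_smul_measure, volume_gridCell hm, ENNReal.toReal_inv,
    ENNReal.toReal_ofReal (by positivity), smul_eq_mul, one_div, inv_inv]

theorem variance_inner_gridCell {d m : ℕ} (hm : 0 < m) (k : Fin d → Fin m)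
    (g : EuclideanSpace ℝ (Fin d)) :
    Var[fun x => inner ℝ g x; cond volume (gridCell d m k)] = ‖g‖ ^ 2 / (12 * (m : ℝ) ^ 2) := by
  have hm' : (0 : ℝ) < m := by exact_mod_cast hm
  have hab : ∀ j, ((k j : ℕ) : ℝ) / (m : ℝ) < (((k j : ℕ) : ℝ) + 1) / (m : ℝ) := by
    intro j; gcongr; linarith
  have h := variance_linear_pi_cond_Icc hab (fun j => g j)
  rw [← map_ofLp_cond_box hab, ← gridCell_eq_preimage,
    variance_map (Measurable.aemeasurable (by fun_prop)) (PiLp.volume_preserving_ofLp _).measurable.aemeasurable] at h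
  have e : ((fun x : Fin d → ℝ => ∑ j, g j * x j) ∘ WithLp.ofLp) =
      fun x : EuclideanSpace ℝ (Fin d) => inner ℝ g x := by
    ext x
    simp [PiLp.inner_apply, mul_comm]
  rw [e] at h
  rw [h, EuclideanSpace.norm_sq_eq, Finset.sum_div]
  refine Finset.sum_congr rfl fun j _ => ?_
  rw [Real.norm_eq_abs, sq_abs]
  field_simp
  ring

theorem gridCell_subset_unitCube {d m : ℕ} (k : Fin d → Fin m) : gridCell d m k ⊆ unitCube d := by
  intro x hx j
  have hm : (0 : ℝ) < m := by exact_mod_cast (Nat.zero_le _).trans_lt (k j).2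
  refine ⟨le_trans (by positivity) (hx j).1, (hx j).2.trans ?_⟩
  rw [div_le_one hm]
  exact_mod_cast (k j).2

theorem iUnion_gridCell {d m : ℕ} (hm : 0 < m) : ⋃ k, gridCell d m k = unitCube d := by
  refine Set.Subset.antisymm (Set.iUnion_subset gridCell_subset_unitCube) fun x hx => ?_
  have hm' : (0 : ℝ) < m := by exact_mod_cast hm
  have key : ∀ j, ∃ i : Fin m, x j ∈ Set.Icc (((i : ℕ) : ℝ) / (m : ℝ))
      ((((i : ℕ) : ℝ) + 1) / (m : ℝ)) := by
    intro j
    obtain ⟨h0, h1⟩ := hx j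
    rcases h1.eq_or_lt with h1 | h1
    -- On the face `x j = 1` the floor would be `m`, outside the index range, so the last cell is
    -- taken.
    · refine ⟨⟨m - 1, by omega⟩, ?_⟩
      rw [h1, Set.mem_Icc, div_le_one hm', le_div_iff₀ hm']
      simp only [Nat.cast_pred hm]
      constructor <;> linarith
    · have hxm : 0 ≤ x j * m := by positivity
      refine ⟨⟨⌊x j * m⌋₊, (Nat.floor_lt hxm).2 (by nlinarith)⟩, ?_⟩
      rw [Set.mem_Icc, div_le_iff₀ hm', le_div_iff₀ hm']
      exact ⟨Nat.floor_le hxm, (Nat.lt_floor_add_one _).le⟩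
  choose i hi using key
  exact Set.mem_iUnion.2 ⟨i, hi⟩

/-- Closed cells may share a face, but indices differing in coordinate `j` force the overlap into a
hyperplane `x j = const`. -/
theorem aedisjoint_gridCell {d m : ℕ} {k l : Fin d → Fin m} (hkl : k ≠ l) :
    AEDisjoint volume (gridCell d m k) (gridCell d m l) := by
  obtain ⟨j, hj⟩ := Function.ne_iff.1 hkl
  wlog hlt : (k j : ℕ) < l j generalizing k l
  · exact (this hkl.symm hj.symm (by have := Fin.val_ne_of_ne hj; omega)).symm
  have hm : (0 : ℝ) < m := by exact_mod_cast (Nat.zero_le _).trans_lt (k j).2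
  have hsub : gridCell d m k ∩ gridCell d m l ⊆
      WithLp.ofLp ⁻¹' {y : Fin d → ℝ | y j = ((l j : ℕ) : ℝ) / m} := by
    rintro x ⟨hk, hl⟩
    refine le_antisymm ((hk j).2.trans ?_) (hl j).1
    gcongr
    exact_mod_cast hlt
  refine measure_mono_null hsub ?_
  have hms : MeasurableSet {y : Fin d → ℝ | y j = ((l j : ℕ) : ℝ) / m} :=
    measurableSet_eq_fun (measurable_pi_apply j) measurable_const
  rw [(PiLp.volume_preserving_ofLp _).measure_preimage hms.nullMeasurableSet, volume_pi]
  exact Measure.pi_hyperplane _ _ _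

theorem sum_integral_gridCell {d m : ℕ} (hm : 0 < m) {g : EuclideanSpace ℝ (Fin d) → ℝ}
    (hg : IntegrableOn g (unitCube d)) :
    ∑ k, ∫ x in gridCell d m k, g x = ∫ x in unitCube d, g x := by
  rw [← iUnion_gridCell hm] at hg ⊢
  rw [integral_iUnion_ae (fun k => (measurableSet_gridCell d m k).nullMeasurableSet)
    (fun k l hkl => aedisjoint_gridCell hkl) hg, tsum_fintype]

theorem norm_sub_le_of_mem_gridCell {d m : ℕ} {k : Fin d → Fin m} {x y : EuclideanSpace ℝ (Fin d)}
    (hx : x ∈ gridCell d m k) (hy : y ∈ gridCell d m k) : ‖x - y‖ ≤ √d / m := by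
  have hj : ∀ j, ‖(x - y) j‖ ^ 2 ≤ (1 / (m : ℝ)) ^ 2 := by
    intro j
    have h1 := hx j
    have h2 := hy j
    rw [Set.mem_Icc, add_div] at h1 h2
    rw [Real.norm_eq_abs]
    refine pow_le_pow_left₀ (abs_nonneg _) ?_ 2
    rw [PiLp.sub_apply, abs_le]
    constructor <;> linarith
  rw [EuclideanSpace.norm_eq]
  calc √(∑ j, ‖(x - y) j‖ ^ 2) ≤ √(d * (1 / (m : ℝ)) ^ 2) := by
        refine Real.sqrt_le_sqrt ((Finset.sum_le_sum fun j _ => hj j).trans (by simp))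
    _ = √d / m := by
        rw [Real.sqrt_mul (by positivity), Real.sqrt_sq (by positivity), mul_one_div]

theorem convex_gridCell {d m : ℕ} (k : Fin d → Fin m) : Convex ℝ (gridCell d m k) := by
  rw [gridCell_eq_preimage]
  exact (convex_pi fun j _ => convex_Icc _ _).is_linear_preimage
    (WithLp.linearEquiv 2 ℝ (Fin d → ℝ)).isLinear

theorem unitCube_eq_preimage (d : ℕ) :
    unitCube d = WithLp.ofLp ⁻¹' (Set.univ.pi fun _ => Set.Icc (0 : ℝ) 1) := by
  ext x; simp only [unitCube, Set.mem_preimage, Set.mem_univ_pi, Set.mem_ofPred_eq]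

theorem convex_unitCube (d : ℕ) : Convex ℝ (unitCube d) := by
  rw [unitCube_eq_preimage]
  exact (convex_pi fun j _ => convex_Icc _ _).is_linear_preimage
    (WithLp.linearEquiv 2 ℝ (Fin d → ℝ)).isLinear

theorem isCompact_unitCube (d : ℕ) : IsCompact (unitCube d) := by
  rw [unitCube_eq_preimage]
  exact (EuclideanSpace.equiv (Fin d) ℝ).toHomeomorph.isCompact_preimage.2
    (isCompact_univ_pi fun _ => isCompact_Icc)

/-- A convex set with nonempty interior has unique derivatives up to its boundary; this makes the
derivative within the cube continuous on the whole cube. -/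
theorem uniqueDiffOn_unitCube (d : ℕ) : UniqueDiffOn ℝ (unitCube d) := by
  refine uniqueDiffOn_convex (convex_unitCube d) ?_
  have ho : IsOpen (WithLp.ofLp ⁻¹' (Set.univ.pi fun _ : Fin d => Set.Ioo (0 : ℝ) 1) :
      Set (EuclideanSpace ℝ (Fin d))) :=
    (isOpen_set_pi Set.finite_univ fun _ _ => isOpen_Ioo).preimage (by fun_prop)
  refine ⟨WithLp.toLp 2 fun _ => 1 / 2, interior_maximal ?_ ho ?_⟩
  · rw [unitCube_eq_preimage]
    exact Set.preimage_mono (Set.pi_mono fun _ _ => Set.Ioo_subset_Icc_self)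
  · intro j _
    norm_num

/-! ### Cell variances and their limit. -/

/-- The difference is `2 cov[X, Y] + Var[Y]`; centring at most doubles each bound, so `|cov| ≤ 4AB`,
and Popoviciu's inequality gives `Var[Y] ≤ B²`. -/
theorem abs_variance_add_sub_le {Ω : Type*} [MeasurableSpace Ω] {μ : Measure Ω}
    [IsProbabilityMeasure μ] {X Y : Ω → ℝ} (hX : AEMeasurable X μ) (hY : AEMeasurable Y μ)
    {A B : ℝ} (hA : ∀ᵐ ω ∂μ, |X ω| ≤ A) (hB : ∀ᵐ ω ∂μ, |Y ω| ≤ B) :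
    |Var[X + Y; μ] - Var[X; μ]| ≤ 8 * A * B + B ^ 2 := by
  simp only [← Real.norm_eq_abs] at hA hB
  have hXA := norm_integral_le_of_norm_le_const hA
  have hYB := norm_integral_le_of_norm_le_const hB
  simp only [probReal_univ, mul_one, Real.norm_eq_abs] at hA hB hXA hYB
  have hcov : |cov[X, Y; μ]| ≤ (2 * A) * (2 * B) := by
    have h : ∀ᵐ ω ∂μ, ‖(X ω - μ[X]) * (Y ω - μ[Y])‖ ≤ (2 * A) * (2 * B) := by
      filter_upwards [hA, hB] with ω ha hb
      rw [norm_mul]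
      have h1 : ‖X ω - μ[X]‖ ≤ 2 * A := (norm_sub_le _ _).trans (by
        simp only [Real.norm_eq_abs]; linarith)
      have h2 : ‖Y ω - μ[Y]‖ ≤ 2 * B := (norm_sub_le _ _).trans (by
        simp only [Real.norm_eq_abs]; linarith)
      exact mul_le_mul h1 h2 (norm_nonneg _) ((norm_nonneg _).trans h1)
    simpa [covariance] using norm_integral_le_of_norm_le_const h
  have hvar : Var[Y; μ] ≤ B ^ 2 := by
    have := variance_le_sq_of_bounded (a := -B) (b := B)
      (by filter_upwards [hB] with ω hω using abs_le.1 hω) hY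
    rwa [show (B - -B) / 2 = B by ring] at this
  rw [variance_add (MemLp.of_bound hX.aestronglyMeasurable A hA)
    (MemLp.of_bound hY.aestronglyMeasurable B hB)]
  have h0 := variance_nonneg Y μ
  rw [abs_le] at hcov ⊢
  constructor <;> nlinarith

section GridCell

variable {d m : ℕ} {f : EuclideanSpace ℝ (Fin d) → ℝ}

theorem isProbabilityMeasure_cond_gridCell (hm : 0 < m) (k : Fin d → Fin m) :
    IsProbabilityMeasure (ProbabilityTheory.cond volume (gridCell d m k)) :=
  cond_isProbabilityMeasure_of_finite (volume_gridCell_ne_zero hm k) (volume_gridCell_ne_top hm k)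

theorem aemeasurable_cond_gridCell {g : EuclideanSpace ℝ (Fin d) → ℝ}
    (hg : ContinuousOn g (unitCube d)) (k : Fin d → Fin m) :
    AEMeasurable g (ProbabilityTheory.cond volume (gridCell d m k)) :=
  ((hg.mono (gridCell_subset_unitCube k)).aemeasurable (measurableSet_gridCell d m k)).smul_measure _

theorem norm_gradientWithin (s : Set (EuclideanSpace ℝ (Fin d))) (x : EuclideanSpace ℝ (Fin d)) :
    ‖gradientWithin f s x‖ = ‖fderivWithin ℝ f s x‖ :=
  LinearIsometryEquiv.norm_map _ _

theorem continuousOn_fderivWithin_unitCube (hf : ContDiffOn ℝ 1 f (unitCube d)) :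
    ContinuousOn (fderivWithin ℝ f (unitCube d)) (unitCube d) :=
  hf.continuousOn_fderivWithin (uniqueDiffOn_unitCube d) le_rfl

theorem continuousOn_norm_gradientWithin_sq (hf : ContDiffOn ℝ 1 f (unitCube d)) :
    ContinuousOn (fun x => ‖gradientWithin f (unitCube d) x‖ ^ 2) (unitCube d) := by
  simp_rw [norm_gradientWithin]
  exact (continuousOn_fderivWithin_unitCube hf).norm.pow 2

/-- Linearize `f` at a point `c` of the cell: the linear part has known variance and the remainder
is at most `ε√d/m`. The factor `m²` cancels the squared diameter. The term `Mε/6` is the cost of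
replacing `‖∇f(c)‖²/12` by its cell average. -/
theorem abs_variance_gridCell_sub_le (hf : ContDiffOn ℝ 1 f (unitCube d)) (hm : 0 < m)
    (k : Fin d → Fin m) {M ε : ℝ} (hM : ∀ x ∈ unitCube d, ‖fderivWithin ℝ f (unitCube d) x‖ ≤ M)
    (hε : ∀ x ∈ gridCell d m k, ∀ y ∈ gridCell d m k,
      ‖fderivWithin ℝ f (unitCube d) x - fderivWithin ℝ f (unitCube d) y‖ ≤ ε) :
    |(m : ℝ) ^ 2 * Var[f; ProbabilityTheory.cond volume (gridCell d m k)] - (1 / 12) *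
      ∫ x, ‖gradientWithin f (unitCube d) x‖ ^ 2
        ∂(ProbabilityTheory.cond volume (gridCell d m k))| ≤
      d * (8 * M * ε + ε ^ 2) + M * ε / 6 := by
  have hm' : (0 : ℝ) < m := by exact_mod_cast hm
  have hprob := isProbabilityMeasure_cond_gridCell hm k
  set ν := ProbabilityTheory.cond volume (gridCell d m k) with hν
  set D := fderivWithin ℝ f (unitCube d) with hD
  have hsub := gridCell_subset_unitCube k
  have hmem : ∀ᵐ x ∂ν, x ∈ gridCell d m k := ae_cond_mem (measurableSet_gridCell d m k)
  obtain ⟨c, hc⟩ : (gridCell d m k).Nonempty :=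
    nonempty_of_measure_ne_zero (volume_gridCell_ne_zero hm k)
  have hM0 : 0 ≤ M := (norm_nonneg _).trans (hM c (hsub hc))
  have hε0 : 0 ≤ ε := (norm_nonneg _).trans (hε c hc c hc)
  have hfm : AEMeasurable f ν := aemeasurable_cond_gridCell hf.continuousOn k
  set X : EuclideanSpace ℝ (Fin d) → ℝ := fun x => D c (x - c) with hX
  set Y : EuclideanSpace ℝ (Fin d) → ℝ := fun x => f x - f c - D c (x - c) with hY
  have hXm : AEMeasurable X ν := Measurable.aemeasurable (by fun_prop)
  have hYm : AEMeasurable Y ν := (hfm.sub_const _).sub hXm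
  have hXA : ∀ᵐ x ∂ν, |X x| ≤ M * (√d / m) := by
    filter_upwards [hmem] with x hx
    exact ((D c).le_opNorm _).trans (mul_le_mul (hM c (hsub hc))
      (norm_sub_le_of_mem_gridCell hx hc) (norm_nonneg _) hM0)
  have hYB : ∀ᵐ x ∂ν, |Y x| ≤ ε * (√d / m) := by
    filter_upwards [hmem] with x hx
    -- Mean value inequality for `f - D c`, whose derivative is bounded by `ε` on the convex cell.
    have h := (convex_gridCell k).norm_image_sub_le_of_norm_hasFDerivWithin_le' (f := f)
      (f' := D) (φ := D c) (C := ε) (fun y hy =>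
        ((hf.differentiableOn one_ne_zero y (hsub hy)).hasFDerivWithinAt).mono hsub)
      (fun y hy => hε y hy c hc) hc hx
    exact h.trans (mul_le_mul_of_nonneg_left (norm_sub_le_of_mem_gridCell hx hc) hε0)
  have hvar := abs_variance_add_sub_le hXm hYm hXA hYB
  have hVf : Var[X + Y; ν] = Var[f; ν] := by
    have : X + Y = fun x => f x + (-f c) := by
      ext x; simp only [hX, hY, Pi.add_apply]; ring
    rw [this, variance_add_const hfm.aestronglyMeasurable]
  have hVX : Var[X; ν] = ‖D c‖ ^ 2 / (12 * (m : ℝ) ^ 2) := by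
    have : X = fun x => inner ℝ (gradientWithin f (unitCube d) c) x + (-D c c) := by
      ext x
      simp only [hX, map_sub, hD, inner_gradientWithin_left]
      ring
    rw [this, variance_add_const (by fun_prop), variance_inner_gridCell hm, norm_gradientWithin]
  rw [hVf, hVX] at hvar
  have hint : |‖D c‖ ^ 2 - ∫ x, ‖gradientWithin f (unitCube d) x‖ ^ 2 ∂ν| ≤ 2 * M * ε := by
    have hi : Integrable (fun x => ‖gradientWithin f (unitCube d) x‖ ^ 2) ν := by
      refine Integrable.of_bound (aemeasurable_cond_gridCell
        (continuousOn_norm_gradientWithin_sq hf) k).aestronglyMeasurable (M ^ 2) ?_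
      filter_upwards [hmem] with x hx
      rw [norm_pow, norm_norm, norm_gradientWithin]
      exact pow_le_pow_left₀ (norm_nonneg _) (hM x (hsub hx)) 2
    have e : ‖D c‖ ^ 2 - ∫ x, ‖gradientWithin f (unitCube d) x‖ ^ 2 ∂ν =
        ∫ x, (‖D c‖ ^ 2 - ‖gradientWithin f (unitCube d) x‖ ^ 2) ∂ν := by
      rw [integral_sub (integrable_const _) hi]; simp
    rw [e]
    have h : ∀ᵐ x ∂ν, ‖‖D c‖ ^ 2 - ‖gradientWithin f (unitCube d) x‖ ^ 2‖ ≤ 2 * M * ε := by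
      filter_upwards [hmem] with x hx
      rw [norm_gradientWithin, Real.norm_eq_abs, sq_sub_sq, abs_mul]
      have h1 := (abs_norm_sub_norm_le (D c) (D x)).trans (hε c hc x hx)
      have h2 : |‖D c‖ + ‖D x‖| ≤ 2 * M := by
        rw [abs_of_nonneg (by positivity)]
        linarith [hM c (hsub hc), hM x (hsub hx)]
      exact mul_le_mul h2 h1 (abs_nonneg _) (by positivity)
    simpa using norm_integral_le_of_norm_le_const h
  have hscale : |(m : ℝ) ^ 2 * Var[f; ν] - ‖D c‖ ^ 2 / 12| ≤ d * (8 * M * ε + ε ^ 2) := by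
    have e : (m : ℝ) ^ 2 * Var[f; ν] - ‖D c‖ ^ 2 / 12 =
        (m : ℝ) ^ 2 * (Var[f; ν] - ‖D c‖ ^ 2 / (12 * (m : ℝ) ^ 2)) := by
      field_simp
    rw [e, abs_mul, abs_of_nonneg (by positivity)]
    refine (mul_le_mul_of_nonneg_left hvar (by positivity)).trans (le_of_eq ?_)
    have hd : √(d : ℝ) ^ 2 = d := Real.sq_sqrt (by positivity)
    calc _ = √(d : ℝ) ^ 2 * (8 * M * ε + ε ^ 2) := by field_simp
      _ = _ := by rw [hd]
  rw [abs_le] at hint hscale ⊢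
  constructor <;> linarith [hint.1, hint.2, hscale.1, hscale.2]

theorem exists_norm_fderivWithin_unitCube_le (hf : ContDiffOn ℝ 1 f (unitCube d)) :
    ∃ M, 0 ≤ M ∧ ∀ x ∈ unitCube d, ‖fderivWithin ℝ f (unitCube d) x‖ ≤ M := by
  obtain ⟨M, hM⟩ := (isCompact_unitCube d).exists_bound_of_continuousOn
    (continuousOn_fderivWithin_unitCube hf)
  exact ⟨max M 0, le_max_right _ _, fun x hx => (hM x hx).trans (le_max_left _ _)⟩

theorem average_integral_cond_gridCell (hm : 0 < m) {g : EuclideanSpace ℝ (Fin d) → ℝ}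
    (hg : ContinuousOn g (unitCube d)) :
    (1 / ((m ^ d : ℕ) : ℝ)) * ∑ k, ∫ x, g x ∂(ProbabilityTheory.cond volume (gridCell d m k)) =
      ∫ x in unitCube d, g x := by
  have hn : (0 : ℝ) < (m ^ d : ℕ) := by positivity
  simp_rw [integral_cond_gridCell hm]
  rw [← Finset.mul_sum, sum_integral_gridCell hm (hg.integrableOn_compact (isCompact_unitCube d)),
    ← mul_assoc, one_div, inv_mul_cancel₀ hn.ne', one_mul]

/-- The normalized sum of the variances of `f` over the cells converges. -/
theorem tendsto_sum_variance_gridCell (hf : ContDiffOn ℝ 1 f (unitCube d)) :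
    Tendsto (fun m : ℕ => (1 / ((m ^ d : ℕ) : ℝ)) *
      ∑ k : Fin d → Fin m, (m : ℝ) ^ 2 * Var[f; ProbabilityTheory.cond volume (gridCell d m k)])
      atTop (𝓝 (gridSigmaSq f)) := by
  obtain ⟨M, hM0, hM⟩ := exists_norm_fderivWithin_unitCube_le hf
  have huc := (isCompact_unitCube d).uniformContinuousOn_of_continuous
    (continuousOn_fderivWithin_unitCube hf)
  rw [Metric.uniformContinuousOn_iff] at huc
  refine Metric.tendsto_nhds.2 fun η hη => ?_
  -- For `ε ≤ 1` the cell error `d(8Mε + ε²) + Mε/6` is at most `Kε`.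
  set K : ℝ := d * (8 * M + 1) + M with hK
  have hK0 : 0 ≤ K := by positivity
  set ε := min 1 (η / (2 * (K + 1))) with hε
  have hε0 : 0 < ε := lt_min one_pos (by positivity)
  have hε1 : ε ≤ 1 := min_le_left _ _
  have hKε : K * ε < η := by
    have h1 : ε * (2 * (K + 1)) ≤ η := (le_div_iff₀ (by positivity)).1 (min_le_right _ _)
    nlinarith
  obtain ⟨δ, hδ, hδε⟩ := huc ε hε0
  have hsmall : Tendsto (fun m : ℕ => √(d : ℝ) / m) atTop (𝓝 0) :=
    tendsto_const_div_atTop_nhds_zero_nat _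
  filter_upwards [hsmall.eventually_lt_const hδ, eventually_gt_atTop 0] with m hmδ hm
  have hn : (0 : ℝ) < (m ^ d : ℕ) := by positivity
  have hcell : ∀ k : Fin d → Fin m, |(m : ℝ) ^ 2 * Var[f; ProbabilityTheory.cond volume
      (gridCell d m k)] - (1 / 12) * ∫ x, ‖gradientWithin f (unitCube d) x‖ ^ 2
        ∂(ProbabilityTheory.cond volume (gridCell d m k))| ≤ K * ε := by
    intro k
    have h := abs_variance_gridCell_sub_le hf hm k hM (ε := ε) (fun x hx y hy => by
      rw [← dist_eq_norm]
      refine (hδε x (gridCell_subset_unitCube k hx) y (gridCell_subset_unitCube k hy) ?_).le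
      rw [dist_eq_norm]
      exact (norm_sub_le_of_mem_gridCell hx hy).trans_lt hmδ)
    refine h.trans ?_
    have h2 : ε ^ 2 ≤ ε := by nlinarith
    have h3 : (d : ℝ) * ε ^ 2 ≤ d * ε := mul_le_mul_of_nonneg_left h2 (by positivity)
    have h4 : 0 ≤ M * ε := by positivity
    rw [hK]
    linarith
  rw [Real.dist_eq, gridSigmaSq,
    ← average_integral_cond_gridCell hm (continuousOn_norm_gradientWithin_sq hf),
    mul_left_comm, ← mul_sub, Finset.mul_sum, ← Finset.sum_sub_distrib, abs_mul,
    abs_of_nonneg (by positivity)]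
  refine lt_of_le_of_lt ?_ hKε
  calc _ ≤ (1 / ((m ^ d : ℕ) : ℝ)) * ∑ _k : Fin d → Fin m, K * ε :=
        mul_le_mul_of_nonneg_left ((Finset.abs_sum_le_sum_abs _ _).trans
          (Finset.sum_le_sum fun k _ => hcell k)) (by positivity)
    _ = K * ε := by
        rw [Finset.sum_const, Finset.card_univ, Fintype.card_fun, Fintype.card_fin,
          Fintype.card_fin, nsmul_eq_mul]
        field_simp

theorem abs_sub_integral_gridCell_le (hf : ContDiffOn ℝ 1 f (unitCube d)) (hm : 0 < m)
    (k : Fin d → Fin m) {M : ℝ} (hM : ∀ x ∈ unitCube d, ‖fderivWithin ℝ f (unitCube d) x‖ ≤ M)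
    {x : EuclideanSpace ℝ (Fin d)} (hx : x ∈ gridCell d m k) :
    |f x - ∫ y, f y ∂(ProbabilityTheory.cond volume (gridCell d m k))| ≤ M * (√d / m) := by
  have hprob := isProbabilityMeasure_cond_gridCell hm k
  have hsub := gridCell_subset_unitCube k
  have hM0 : 0 ≤ M := (norm_nonneg _).trans (hM x (hsub hx))
  have h : ∀ᵐ y ∂(ProbabilityTheory.cond volume (gridCell d m k)),
      ‖f x - f y‖ ≤ M * (√d / m) := by
    filter_upwards [ae_cond_mem (measurableSet_gridCell d m k)] with y hy
    refine ((convex_unitCube d).norm_image_sub_le_of_norm_fderivWithin_le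
      (hf.differentiableOn one_ne_zero) hM (hsub hy) (hsub hx)).trans ?_
    exact mul_le_mul_of_nonneg_left (norm_sub_le_of_mem_gridCell hx hy) hM0
  have hi : Integrable f (ProbabilityTheory.cond volume (gridCell d m k)) := by
    obtain ⟨C, hC⟩ := (isCompact_unitCube d).exists_bound_of_continuousOn hf.continuousOn
    refine Integrable.of_bound
      (aemeasurable_cond_gridCell hf.continuousOn k).aestronglyMeasurable C ?_
    filter_upwards [ae_cond_mem (measurableSet_gridCell d m k)] with y hy using hC y (hsub hy)
  have e : f x - ∫ y, f y ∂(ProbabilityTheory.cond volume (gridCell d m k)) =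
      ∫ y, (f x - f y) ∂(ProbabilityTheory.cond volume (gridCell d m k)) := by
    rw [integral_sub (integrable_const _) hi]; simp
  rw [e]
  simpa using norm_integral_le_of_norm_le_const h

end GridCell

/-! ### Normalization and the limit theorem. -/

theorem natCast_pow_rpow_neg_half_sub_inv {d m : ℕ} (hd : 1 ≤ d) (hm : 0 < m) :
    ((m ^ d : ℕ) : ℝ) ^ (-(1 / 2 : ℝ) - 1 / (d : ℝ)) = (√((m ^ d : ℕ) : ℝ))⁻¹ * (m : ℝ)⁻¹ := by
  have hn : (0 : ℝ) < (m ^ d : ℕ) := by positivity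
  rw [sub_eq_add_neg, Real.rpow_add hn, Real.rpow_neg hn.le, Real.rpow_neg hn.le,
    ← Real.sqrt_eq_rpow, one_div (d : ℝ), Nat.cast_pow,
    Real.pow_rpow_inv_natCast (by positivity) (by omega)]

theorem gridEstimate_normalized_eq_sum {d m : ℕ} (hd : 1 ≤ d) {f : EuclideanSpace ℝ (Fin d) → ℝ}
    (hf : ContinuousOn f (unitCube d)) (hσ : 0 < gridSigmaSq f) {Ω : Type*} [MeasurableSpace Ω]
    (U : (Fin d → Fin m) → Ω → EuclideanSpace ℝ (Fin d)) (ω : Ω) :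
    (gridEstimate f U ω - cubeIntegral f) /
        (√(gridSigmaSq f) * ((m ^ d : ℕ) : ℝ) ^ (-(1 / 2 : ℝ) - 1 / (d : ℝ))) =
      ∑ k, m / (√(gridSigmaSq f) * √((m ^ d : ℕ) : ℝ)) *
        (f (U k ω) - ∫ x, f x ∂(ProbabilityTheory.cond volume (gridCell d m k))) := by
  rcases Nat.eq_zero_or_pos m with rfl | hm
  -- For `m = 0` both sides are zero: zero to a nonzero power is zero, so the left side is a
  -- division by zero.
  · have h0 : -(1 / 2 : ℝ) - 1 / (d : ℝ) ≠ 0 := by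
      have : 0 ≤ 1 / (d : ℝ) := by positivity
      linarith
    rw [zero_pow (by omega), Nat.cast_zero, Real.zero_rpow h0]
    simp
  · have hσ' : 0 < √(gridSigmaSq f) := Real.sqrt_pos.2 hσ
    have hm' : (0 : ℝ) < m := by exact_mod_cast hm
    rw [natCast_pow_rpow_neg_half_sub_inv hd hm, gridEstimate, cubeIntegral,
      ← average_integral_cond_gridCell hm hf, ← Finset.mul_sum, Finset.sum_sub_distrib]
    have hn : (0 : ℝ) < (m ^ d : ℕ) := by positivity
    have hr : 0 < √((m ^ d : ℕ) : ℝ) := Real.sqrt_pos.2 hn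
    have hr2 : ((m ^ d : ℕ) : ℝ) = √((m ^ d : ℕ) : ℝ) ^ 2 := (Real.sq_sqrt hn.le).symm
    generalize √((m ^ d : ℕ) : ℝ) = r at *
    rw [hr2]
    field_simp

theorem mainTheorem3 (d : ℕ) (hd : 1 ≤ d) (f : EuclideanSpace ℝ (Fin d) → ℝ)
    (hf : ContDiffOn ℝ 1 f (unitCube d)) (hσ : 0 < gridSigmaSq f)
    {Ω : ℕ → Type*} [∀ m, MeasurableSpace (Ω m)] (P : ∀ m, Measure (Ω m))
    [∀ m, IsProbabilityMeasure (P m)]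
    (U : ∀ m, (Fin d → Fin m) → Ω m → EuclideanSpace ℝ (Fin d))
    (hU : ∀ m, IsGridSample (P m) d m (U m)) :
    TendstoInDistribution
      (fun (m : ℕ) (ω : Ω m) =>
        (gridEstimate f (U m) ω - cubeIntegral f) /
          (√(gridSigmaSq f) * ((m ^ d : ℕ) : ℝ) ^ (-(1 / 2 : ℝ) - 1 / (d : ℝ))))
      atTop (id : ℝ → ℝ) P (gaussianReal 0 1) := by
  obtain ⟨M, hM0, hM⟩ := exists_norm_fderivWithin_unitCube_le hf
  have hσ' : 0 < √(gridSigmaSq f) := Real.sqrt_pos.2 hσ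
  simp_rw [gridEstimate_normalized_eq_sum hd hf.continuousOn hσ]
  -- Since `d ≥ 1`, an index `k` exists only if `m > 0`; the stage `m = 0` has no cells.
  have hpos : ∀ {m : ℕ}, (Fin d → Fin m) → 0 < m := fun k =>
    (Nat.zero_le _).trans_lt (k ⟨0, hd⟩).2
  have hUm : ∀ m k, AEMeasurable (U m k) (P m) := fun m k =>
    ((hU m).uniform k).aemeasurable (volume_gridCell_ne_zero (hpos k) k)
      (volume_gridCell_ne_top (hpos k) k)
  have hlaw : ∀ m k, (P m).map (U m k) = ProbabilityTheory.cond volume (gridCell d m k) :=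
    fun m k => (hU m).uniform k
  have hfm : ∀ m k, AEMeasurable f ((P m).map (U m k)) := fun m k => by
    rw [hlaw]; exact aemeasurable_cond_gridCell hf.continuousOn k
  set I : ∀ m, (Fin d → Fin m) → ℝ := fun m k =>
    ∫ x, f x ∂(ProbabilityTheory.cond volume (gridCell d m k)) with hI
  set s : ℕ → ℝ := fun m => m / (√(gridSigmaSq f) * √((m ^ d : ℕ) : ℝ)) with hs
  have hs0 : ∀ m, 0 ≤ s m := fun m => by positivity
  have hgm : ∀ m k, AEMeasurable (fun x => s m * (f x - I m k)) ((P m).map (U m k)) :=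
    fun m k => ((hfm m k).sub_const _).const_mul _
  have hmemU : ∀ m k, ∀ᵐ ω ∂P m, U m k ω ∈ gridCell d m k := fun m k => by
    refine ae_of_ae_map (hUm m k) ?_
    rw [hlaw]
    exact ae_cond_mem (measurableSet_gridCell d m k)
  have hbound : ∀ m k, ∀ᵐ ω ∂P m, |f (U m k ω) - I m k| ≤ M * (√d / m) := fun m k => by
    filter_upwards [hmemU m k] with ω hω using abs_sub_integral_gridCell_le hf (hpos k) k hM hω
  have hmean : ∀ m k, ∫ ω, f (U m k ω) ∂P m = I m k := fun m k => by
    rw [← integral_map (hUm m k) (hfm m k).aestronglyMeasurable, hlaw]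
  have hXm : ∀ m k, AEMeasurable (fun ω => f (U m k ω) - I m k) (P m) := fun m k =>
    ((hfm m k).comp_aemeasurable (hUm m k)).sub_const _
  have hsq : ∀ m k, ∫ ω, (s m * (f (U m k ω) - I m k)) ^ 2 ∂P m =
      s m ^ 2 * Var[f; ProbabilityTheory.cond volume (gridCell d m k)] := fun m k => by
    simp_rw [mul_pow]
    rw [integral_const_mul, ← hlaw, variance_map (hfm m k) (hUm m k),
      variance_eq_integral ((hfm m k).comp_aemeasurable (hUm m k))]
    simp only [Function.comp_apply, hmean]
  refine tendstoInDistribution_sum_of_bounded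
    (X := fun m k ω => s m * (f (U m k ω) - I m k))
    -- This is `s m` times the oscillation bound `M√d/m`: the factors `m` cancel and `n^(-1/2)`
    -- remains.
    (C := fun m => M * √d / √(gridSigmaSq f) * (√((m ^ d : ℕ) : ℝ))⁻¹)
    (fun m k => (hXm m k).const_mul _)
    (fun m => (hU m).indep.comp₀ (fun k x => s m * (f x - I m k)) (hUm m) (hgm m))
    (fun m k => ?_) (fun m => by positivity) (fun m k => ?_) ?_ ?_
  · have hi : Integrable (fun ω => f (U m k ω)) (P m) := by
      have := (Integrable.of_bound (hXm m k).aestronglyMeasurable _ (hbound m k)).add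
        (integrable_const (I m k))
      simpa [Pi.add_def] using this
    rw [integral_const_mul, integral_sub hi (integrable_const _), hmean]
    simp
  · have hm : (0 : ℝ) < m := by exact_mod_cast hpos k
    filter_upwards [hbound m k] with ω hω
    rw [abs_mul, abs_of_nonneg (hs0 m)]
    refine (mul_le_mul_of_nonneg_left hω (hs0 m)).trans (le_of_eq ?_)
    have hr : 0 < √((m ^ d : ℕ) : ℝ) := Real.sqrt_pos.2 (by exact_mod_cast pow_pos (hpos k) d)
    simp only [hs]
    field_simp
  · have hpow : Tendsto (fun m : ℕ => √((m ^ d : ℕ) : ℝ)) atTop atTop :=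
      Real.tendsto_sqrt_atTop.comp
        (tendsto_natCast_atTop_atTop.comp (tendsto_pow_atTop (by omega)))
    simpa using hpow.inv_tendsto_atTop.const_mul (M * √d / √(gridSigmaSq f))
  -- As `s m ^ 2 = m² / (σ² n)`, the total variance is the normalized cell-variance sum divided by
  -- its limit `σ²`.
  · have h := (tendsto_sum_variance_gridCell hf).const_mul (gridSigmaSq f)⁻¹
    rw [inv_mul_cancel₀ hσ.ne'] at h
    refine h.congr fun m => ?_
    simp_rw [hsq, hs, ← Finset.mul_sum]
    rw [div_pow, mul_pow, Real.sq_sqrt hσ.le, Real.sq_sqrt (Nat.cast_nonneg _)]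
    generalize ((m ^ d : ℕ) : ℝ) = n
    rw [one_div, div_eq_mul_inv, mul_inv]
    ring
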